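/- **Theorem.** Let $I\subseteq\mathbb{R}$ be a nonempty interval and $n\ge 2$. For $S\subseteq\mathbb{R}$ let $S^k_\le$ and $S^k_<$ denote the sets of all increasing, respectively strictly increasing, $k$-tuples of elements of $S$. Let $M_1,\dots,M_n:I^2_\le\to I$ be means, i.e. $u\le M_i(u,v)\le v$ for all $(u,v)\in I^2_\le$; a mean $M_i$ is called strict if $u<M_i(u,v)<v$ for all $(u,v)\in I^2_<$. For $(x,y)\in I^2_<$ define $\varphi_{(x,y)}:[x,y]^n_\le\to\mathbb{R}^n$ by $$\varphi_{(x,y)}(t_1,\dots,t_n):=\big(M_1(x,t_2),\dots,M_i(t_{i-1},t_{i+1}),\dots,M_n(t_{n-1},y)\big)$$ and let $\Phi_{(x,y)}:=\{\xi\in[x,y]^n_\le \mid \varphi_{(x,y)}(\xi)=\xi\}$. Then, for all $(x,y)\in I^2_<$, the following statements hold. 1. If all the means $M_1,\dots,M_n$ are continuous, then $\Phi_{(x,y)}$ is nonempty and compact. If all the means $M_1,\dots,M_n$ are strict (continuous or not), then $\Phi_{(x,y)}\subseteq\,]x,y[^n_<$. 2. Suppose that there exist semimetrics $d_1,\dots,d_n:[x,y]^2\to[0,\infty[$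 (that is, $d_i(s,t)=d_i(t,s)$, and $d_i(s,t)=0$ if and only if $s=t$; no triangle inequality is required) and positive real numbers $a_2,\dots,a_n$ and $b_1,\dots,b_{n-1}$ such that $$d_1(M_1(x,s),M_1(x,v))\le b_1d_2(s,v),\qquad d_n(M_n(t,y),M_n(u,y))\le a_nd_{n-1}(t,u)$$ for all $t,s,u,v\in[x,y]$, and, for $i\in\{2,\dots,n-1\}$, $$d_i(M_i(t,s),M_i(u,v))\le a_id_{i-1}(t,u)+b_id_{i+1}(s,v)$$ for all $(t,s),(u,v)\in[x,y]^2_\le$, and such that $w_1,\dots,w_{n-1}>0$, where $w_{-1}:=w_0:=1$ and $w_i:=w_{i-1}-a_{i+1}b_iw_{i-2}$ for $i\in\{1,\dots,n-1\}$. Then $\Phi_{(x,y)}$ has at most one element; if, in addition, all the means $M_1,\dots,M_n$ are continuous, then $\Phi_{(x,y)}$ is a singleton. -/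

import Mathlib

/-- The set `S_≤^2` of ordered pairs of elements of `S`. -/
def orderedPairs (S : Set ℝ) : Set (ℝ × ℝ) :=
  {p | p.1 ∈ S ∧ p.2 ∈ S ∧ p.1 ≤ p.2}

/-- The set `S_≤^n` of increasingly ordered `n`-tuples of elements of `S`. -/
def orderedTuples (n : ℕ) (S : Set ℝ) : Set (Fin n → ℝ) :=
  {t | (∀ i, t i ∈ S) ∧ Monotone t}

/-- The set `S_<^n` of strictly increasingly ordered `n`-tuples of elements of `S`. -/
def strictOrderedTuples (n : ℕ) (S : Set ℝ) : Set (Fin n → ℝ) :=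
  {t | (∀ i, t i ∈ S) ∧ StrictMono t}

/-- `M` is a two-variable mean on `S`. Only the values of `M` on `S_≤^2` matter. -/
def IsMeanOn (S : Set ℝ) (M : ℝ → ℝ → ℝ) : Prop :=
  ∀ x ∈ S, ∀ y ∈ S, x ≤ y → x ≤ M x y ∧ M x y ≤ y

/-- The strictness condition `x < M(x,y) < y` for `x < y` in `S`. -/
def IsStrictMeanOn (S : Set ℝ) (M : ℝ → ℝ → ℝ) : Prop :=
  ∀ x ∈ S, ∀ y ∈ S, x < y → x < M x y ∧ M x y < y

/-- `M` is continuous on `S_≤^2`. -/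
def IsContinuousMeanOn (S : Set ℝ) (M : ℝ → ℝ → ℝ) : Prop :=
  ContinuousOn (fun p : ℝ × ℝ => M p.1 p.2) (orderedPairs S)

/-- For a tuple `t = (t_1, …, t_n)`, stored as `t 0, …, t (n - 1)`, this is the sequence
`t_0 = x, t_1, …, t_n, t_{n+1} = y` (constantly `y` after that). -/
noncomputable def extendTuple {n : ℕ} (x y : ℝ) (t : Fin n → ℝ) (k : ℕ) : ℝ :=
  if k = 0 then x else if h : k - 1 < n then t ⟨k - 1, h⟩ else y

/-- The map `φ_{(x,y)}(t) = (M_1(x,t_2), …, M_i(t_{i-1},t_{i+1}), …, M_n(t_{n-1},y))`;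
the entry at `i : Fin n` has index `i + 1` in the 1-based numbering. -/
noncomputable def phi {n : ℕ} (M : ℕ → ℝ → ℝ → ℝ) (x y : ℝ) (t : Fin n → ℝ) : Fin n → ℝ :=
  fun i => M (i + 1) (extendTuple x y t i) (extendTuple x y t (i + 2))

/-- The set `Φ_{(x,y)}` of the fixed points of `φ_{(x,y)}` in `[x,y]_≤^n`. -/
def fixedPointSet (n : ℕ) (M : ℕ → ℝ → ℝ → ℝ) (x y : ℝ) : Set (Fin n → ℝ) :=
  {ξ | ξ ∈ orderedTuples n (Set.Icc x y) ∧ phi M x y ξ = ξ}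

/-- `d` is a semimetric on `X`: positive definite and symmetric (no triangle inequality). -/
def IsSemimetricOn (X : Set ℝ) (d : ℝ → ℝ → ℝ) : Prop :=
  (∀ s ∈ X, ∀ t ∈ X, 0 ≤ d s t ∧ (d s t = 0 ↔ s = t)) ∧
  (∀ s ∈ X, ∀ t ∈ X, d s t = d t s)

/-- The Lipschitz-type estimates for `M_1, …, M_n` on `[x,y]`. In the middle estimate the
arguments `(t,s)` and `(u,v)` of `M_i` run through the domain `[x,y]_≤^2` of the mean. -/
def LipschitzEstimates (n : ℕ) (M d : ℕ → ℝ → ℝ → ℝ) (a b : ℕ → ℝ) (x y : ℝ) : Prop :=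
  (∀ s ∈ Set.Icc x y, ∀ v ∈ Set.Icc x y,
    d 1 (M 1 x s) (M 1 x v) ≤ b 1 * d 2 s v) ∧
  (∀ i ∈ Set.Icc 2 (n - 1),
    ∀ t ∈ Set.Icc x y, ∀ s ∈ Set.Icc x y, ∀ u ∈ Set.Icc x y, ∀ v ∈ Set.Icc x y,
      t ≤ s → u ≤ v →
        d i (M i t s) (M i u v) ≤ a i * d (i - 1) t u + b i * d (i + 1) s v) ∧
  (∀ t ∈ Set.Icc x y, ∀ u ∈ Set.Icc x y,
    d n (M n t y) (M n u y) ≤ a n * d (n - 1) t u)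

/-- The sequence `w_0, w_1, …` given by `w_{-1} = w_0 = 1` and
`w_i = w_{i-1} - a_{i+1} b_i w_{i-2}` for `i ≥ 1`. -/
def wSeq (a b : ℕ → ℝ) : ℕ → ℝ
  | 0 => 1
  | 1 => 1 - a 2 * b 1 * 1
  | (i + 2) => wSeq a b (i + 1) - a (i + 3) * b (i + 2) * wSeq a b i

/-! Existence is Brouwer's theorem. `phi` is controlled only on increasing tuples, so it is
precomposed with clamping followed by a running maximum; the mean inequalities force every fixed
point of the composite to be increasing, hence a fixed point of `phi`.

Brouwer is derived from the absence of a `C¹` retraction `x + h x` of a ball onto its sphere. For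
small `t > 0` the map `x + t • h x` permutes the ball, so its Jacobian determinant integrates to the
volume. The determinant is polynomial in `t`, so this persists at `t = 1`, where it vanishes on the
open ball.

For strict means, consecutive gaps of `x, ξ_1, …, ξ_n, y` are positive all together or not at all,
and they add up to `y - x > 0`.

For uniqueness, the numbers `d_i(ξ_i, η_i)` of two fixed points satisfy a tridiagonal system of
inequalities; elimination (`eq_zero_of_wSeq_pos`) makes them vanish when the leading minors `w_i`
are positive. -/

/-! ### Brouwer's fixed point theorem -/

/-- A Lipschitz map on a closed ball that vanishes on the boundary sphere remains Lipschitz when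
it is extended by zero. -/
theorem lipschitzWith_indicator_closedBall {E F : Type*} [NormedAddCommGroup E] [NormedSpace ℝ E]
    [NormedAddCommGroup F] {h : E → F} {K : NNReal} {R : ℝ}
    (hh : LipschitzOnWith K h (Metric.closedBall 0 R)) (h0 : ∀ x, ‖x‖ = R → h x = 0) :
    LipschitzWith K ((Metric.closedBall (0 : E) R).indicator h) := by
  have key : ∀ x y : E, ‖x‖ ≤ R → R < ‖y‖ → ‖h x‖ ≤ K * dist x y := by
    intro x y hx hy
    obtain ⟨z, hz, hzR⟩ := (convex_segment (𝕜 := ℝ) x y).isPreconnected.intermediate_value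
      (left_mem_segment ℝ x y) (right_mem_segment ℝ x y) continuous_norm.continuousOn
      ⟨hx, hy.le⟩
    have h1 := hh.dist_le_mul x (by simpa using hx) z (by simpa using le_of_eq hzR)
    rw [h0 z hzR, dist_zero_right] at h1
    have h2 := dist_add_dist_of_mem_segment hz
    have h3 := dist_nonneg (x := z) (y := y)
    exact h1.trans (mul_le_mul_of_nonneg_left (by linarith) K.2)
  refine LipschitzWith.of_dist_le_mul fun x y => ?_
  by_cases hx : ‖x‖ ≤ R <;> by_cases hy : ‖y‖ ≤ R
  · simpa [Set.indicator, hx, hy] using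
      hh.dist_le_mul x (by simpa using hx) y (by simpa using hy)
  · simpa [Set.indicator, hx, hy] using key x y hx (not_le.1 hy)
  · simpa [Set.indicator, hx, hy, dist_comm] using key y x hy (not_le.1 hx)
  · simp only [Set.indicator, Metric.mem_closedBall, dist_zero_right, hx, hy, if_false, dist_self]
    positivity

/-- A perturbation of the identity by a strict contraction is bijective. -/
theorem LipschitzWith.bijective_id_add {E : Type*} [NormedAddCommGroup E] [CompleteSpace E]
    {k : E → E} {K : NNReal} (hk : LipschitzWith K k) (hK : K < 1) :
    Function.Bijective fun x => x + k x := by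
  constructor
  · intro x y hxy
    by_contra hne
    have h1 := hk.dist_le_mul x y
    have h2 : x - y = k y - k x := by
      have : x + k x = y + k y := hxy
      rw [sub_eq_sub_iff_add_eq_add, this, add_comm]
    have h3 : dist x y = dist (k x) (k y) := by
      rw [dist_eq_norm, h2, dist_comm, dist_eq_norm]
    have h4 : 0 < dist x y := dist_pos.2 hne
    have h5 : (K : ℝ) < 1 := hK
    nlinarith
  · intro y
    have hc : ContractingWith K fun x => y - k x := by
      refine ⟨hK, LipschitzWith.of_dist_le_mul fun a b => ?_⟩
      rw [dist_sub_left]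
      exact hk.dist_le_mul a b
    have := hc.fixedPoint_isFixedPt
    refine ⟨ContractingWith.fixedPoint _ hc, ?_⟩
    have h6 : y - k (ContractingWith.fixedPoint _ hc) = ContractingWith.fixedPoint _ hc := this
    exact (sub_eq_iff_eq_add.1 h6).symm

/-- A small Lipschitz perturbation of the identity supported in a set is a bijection of this
set. -/
theorem bijOn_id_add_of_eqOn_zero {E : Type*} [NormedAddCommGroup E] [CompleteSpace E]
    {k : E → E} {K : NNReal} (hk : LipschitzWith K k) (hK : K < 1) {s : Set E}
    (h0 : ∀ x ∉ s, k x = 0) : Set.BijOn (fun x => x + k x) s s := by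
  have hb := hk.bijective_id_add hK
  refine ⟨fun x hx => ?_, hb.1.injOn, fun y hy => ?_⟩
  · by_contra hn
    -- The point `x + k x` outside `s` is fixed by the map, so it and `x` have the same image.
    have : x + k x = x := hb.1 (by simpa using h0 _ hn)
    exact hn (by simpa [this] using hx)
  · obtain ⟨x, rfl⟩ := hb.2 y
    refine ⟨x, ?_, rfl⟩
    by_contra hn
    simp only [h0 x hn, add_zero] at hy
    exact hn hy

open Polynomial in
/-- The determinant of `1 + t A` is a polynomial in `t` of degree at most the dimension. -/
theorem LinearMap.exists_polynomial_det_one_add_smul {E : Type*} [AddCommGroup E] [Module ℝ E]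
    [FiniteDimensional ℝ E] (A : E →ₗ[ℝ] E) :
    ∃ p : ℝ[X], p.natDegree ≤ Module.finrank ℝ E ∧ ∀ t, p.eval t = LinearMap.det (1 + t • A) := by
  classical
  let b := Module.finBasis ℝ E
  let B := LinearMap.toMatrix b b A
  refine ⟨((X : ℝ[X]) • B.map C + (1 : Matrix _ _ ℝ).map C).det, ?_, fun t => ?_⟩
  · simpa using natDegree_det_X_add_C_le B 1
  · rw [← LinearMap.det_toMatrix b, ← coe_evalRingHom t, RingHom.map_det]
    congr 1
    ext i j
    simp [B, LinearMap.toMatrix_one, Matrix.one_apply, apply_ite]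
    split_ifs <;> ring

/-- The determinant of a perturbation of the identity of norm less than one is positive. -/
theorem LinearMap.det_one_add_smul_pos {E : Type*} [NormedAddCommGroup E] [NormedSpace ℝ E]
    [FiniteDimensional ℝ E] (A : E →L[ℝ] E) {t : ℝ} (ht : 0 ≤ t) (hA : t * ‖A‖ < 1) :
    0 < LinearMap.det (1 + t • (A : E →ₗ[ℝ] E)) := by
  obtain ⟨p, -, hp⟩ := LinearMap.exists_polynomial_det_one_add_smul (A : E →ₗ[ℝ] E)
  -- No zero on `[0, t]` and value `1` at `0` force positivity at `t`.
  have hne : ∀ s ∈ Set.Icc 0 t, p.eval s ≠ 0 := by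
    intro s hs h
    rw [hp] at h
    obtain ⟨v, hv, hv0⟩ := Submodule.exists_mem_ne_zero_of_ne_bot
      (LinearMap.bot_lt_ker_of_det_eq_zero h).ne'
    have h1 : v + s • A v = 0 := by simpa using hv
    have h2 : ‖v‖ = s * ‖A v‖ := by
      rw [← Real.norm_of_nonneg hs.1, ← norm_smul, ← norm_neg (_ • _),
        ← eq_neg_of_add_eq_zero_left h1]
    have h3 := A.le_opNorm v
    have h4 : 0 < ‖v‖ := norm_pos_iff.2 hv0
    have h5 : s * ‖A‖ ≤ t * ‖A‖ := mul_le_mul_of_nonneg_right hs.2 (norm_nonneg A)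
    have h6 : s * ‖A v‖ ≤ s * (‖A‖ * ‖v‖) := mul_le_mul_of_nonneg_left h3 hs.1
    nlinarith
  rw [← hp]
  by_contra hn
  obtain ⟨s, hs, hs0⟩ := intermediate_value_Icc' ht p.continuous.continuousOn
    ⟨not_lt.1 hn, by rw [hp]; simp⟩
  exact hne s hs hs0

/-- Polynomial extrapolation to the point `1` from finitely many nodes in `(0, τ)`. -/
theorem exists_extrapolation_weights (d : ℕ) {τ : ℝ} (hτ : 0 < τ) :
    ∃ v c : ℕ → ℝ, (∀ j ∈ Finset.range (d + 1), 0 < v j ∧ v j ≤ τ) ∧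
      ∑ j ∈ Finset.range (d + 1), c j = 1 ∧
      ∀ p : Polynomial ℝ, p.natDegree ≤ d →
        p.eval 1 = ∑ j ∈ Finset.range (d + 1), c j * p.eval (v j) := by
  let v : ℕ → ℝ := fun j => τ / (j + 1)
  have hv : Set.InjOn v (Finset.range (d + 1)) := by
    intro i _ j _ hij
    have hi : (0 : ℝ) < i + 1 := by positivity
    have hj : (0 : ℝ) < j + 1 := by positivity
    simp only [v] at hij
    rw [div_eq_div_iff hi.ne' hj.ne'] at hij
    have := mul_left_cancel₀ hτ.ne' hij
    exact_mod_cast (add_right_cancel this).symm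
  let c : ℕ → ℝ := fun j => (Lagrange.basis (Finset.range (d + 1)) v j).eval 1
  have key : ∀ p : Polynomial ℝ, p.natDegree ≤ d →
      p.eval 1 = ∑ j ∈ Finset.range (d + 1), c j * p.eval (v j) := by
    intro p hp
    have hdeg : p.degree < (Finset.range (d + 1)).card := by
      rw [Finset.card_range]
      exact (Polynomial.degree_le_of_natDegree_le hp).trans_lt (by exact_mod_cast Nat.lt_succ_self d)
    conv_lhs => rw [Lagrange.eq_interpolate hv hdeg]
    simp [Lagrange.interpolate_apply, Polynomial.eval_finsetSum, c, mul_comm]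
  refine ⟨v, c, fun j _ => ⟨by positivity, div_le_self hτ.le (by simp)⟩, ?_, key⟩
  simpa using (key 1 (by simp)).symm

open MeasureTheory in
/-- There is no `C¹` retraction `x ↦ x + h x` of a closed ball onto its boundary sphere. -/
theorem not_forall_norm_add_eq_of_contDiffAt {E : Type*} [NormedAddCommGroup E]
    [InnerProductSpace ℝ E] [FiniteDimensional ℝ E] {h : E → E} {R : ℝ} (hR : 0 < R)
    (hd : ∀ x, ‖x‖ ≤ R → ContDiffAt ℝ 1 h x) (h0 : ∀ x, ‖x‖ = R → h x = 0) :
    ¬ ∀ x, ‖x‖ ≤ R → ‖x + h x‖ = R := by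
  intro hret
  borelize E
  set B := Metric.closedBall (0 : E) R with hB
  have hBm : MeasurableSet B := Metric.isClosed_closedBall.measurableSet
  have memB : ∀ x, x ∈ B ↔ ‖x‖ ≤ R := fun x => by simp [hB]
  have hcont : ContinuousOn (fderiv ℝ h) B := fun x hx =>
    ((hd x ((memB x).1 hx)).fderiv_right (m := 0) (by simp)).continuousAt.continuousWithinAt
  have hder : ∀ x ∈ B, HasFDerivAt h (fderiv ℝ h x) x := fun x hx =>
    ((hd x ((memB x).1 hx)).differentiableAt (by simp)).hasFDerivAt
  obtain ⟨C, hC⟩ := (isCompact_closedBall (0 : E) R).exists_bound_of_continuousOn hcont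
  set K : NNReal := C.toNNReal
  have hCK : ∀ x ∈ B, ‖fderiv ℝ h x‖ ≤ K := fun x hx => (hC x hx).trans (Real.le_coe_toNNReal C)
  have hlip : LipschitzOnWith K h B :=
    (convex_closedBall (0 : E) R).lipschitzOnWith_of_nnnorm_hasFDerivWithin_le
      (fun x hx => (hder x hx).hasFDerivWithinAt) (fun x hx => hCK x hx)
  have hlip' := lipschitzWith_indicator_closedBall hlip h0
  have hτ : (0 : ℝ) < 1 / (K + 1) := by positivity
  obtain ⟨v, c, hv, hc, hp⟩ := exists_extrapolation_weights (Module.finrank ℝ E) hτ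
  let D : ℝ → E → ℝ := fun t x => LinearMap.det (1 + t • (fderiv ℝ h x : E →ₗ[ℝ] E))
  have hsmall : ∀ j ∈ Finset.range (Module.finrank ℝ E + 1), v j * K < 1 := by
    intro j hj
    calc v j * K ≤ 1 / (K + 1) * K := mul_le_mul_of_nonneg_right (hv j hj).2 K.2
      _ < 1 := by
        rw [one_div_mul_eq_div, div_lt_one (by positivity)]
        linarith
  have hDpos : ∀ j ∈ Finset.range (Module.finrank ℝ E + 1), ∀ x ∈ B, 0 < D (v j) x :=
    fun j hj x hx => LinearMap.det_one_add_smul_pos _ (hv j hj).1.le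
      ((mul_le_mul_of_nonneg_left (hCK x hx) (hv j hj).1.le).trans_lt (hsmall j hj))
  -- Change of variables: `x + v j • h x` maps `B` bijectively onto itself with positive Jacobian.
  have hvol : ∀ j ∈ Finset.range (Module.finrank ℝ E + 1),
      ∫ x in B, D (v j) x = volume.real B := by
    intro j hj
    set t := v j
    have ht := (hv j hj).1
    have hbij : Set.BijOn (fun x => x + t • B.indicator h x) B B := by
      refine bijOn_id_add_of_eqOn_zero (K := t.toNNReal * K) ?_ ?_ fun x hx => by simp [hx]
      · refine LipschitzWith.of_dist_le_mul fun x y => ?_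
        rw [dist_smul₀, Real.norm_of_nonneg ht.le, NNReal.coe_mul, Real.coe_toNNReal _ ht.le,
          mul_assoc]
        exact mul_le_mul_of_nonneg_left (hlip'.dist_le_mul x y) ht.le
      · rw [← NNReal.coe_lt_coe, NNReal.coe_mul, Real.coe_toNNReal _ ht.le]
        exact hsmall j hj
    have hbij' : Set.BijOn (fun x => x + t • h x) B B :=
      hbij.congr fun x hx => by simp [hx]
    have hcv := integral_image_eq_integral_abs_det_fderiv_smul volume hBm
      (f := fun x => x + t • h x) (f' := fun x => ContinuousLinearMap.id ℝ E + t • fderiv ℝ h x)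
      (fun x hx => ((hasFDerivAt_id x).add ((hder x hx).const_smul t)).hasFDerivWithinAt)
      hbij'.injOn (fun _ => (1 : ℝ))
    rw [hbij'.image_eq] at hcv
    simp only [integral_const, smul_eq_mul, mul_one, measureReal_restrict_apply_univ] at hcv
    rw [hcv]
    refine setIntegral_congr_fun hBm fun x hx => ?_
    exact (abs_of_pos (hDpos j hj x hx)).symm
  have hint : ∀ j ∈ Finset.range (Module.finrank ℝ E + 1),
      Integrable (fun x => c j * D (v j) x) (volume.restrict B) := by
    intro j hj
    refine Integrable.const_mul ?_ _
    -- A non-integrable function has integral `0` by convention, but `hvol` gives a positive value.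
    by_contra hni
    have h1 := hvol j hj
    rw [integral_undef hni] at h1
    have h2 : 0 < volume.real B := by
      refine ENNReal.toReal_pos (Metric.measure_closedBall_pos _ _ hR).ne' ?_
      exact (isCompact_closedBall (0 : E) R).measure_lt_top.ne
    exact h2.ne h1
  -- `‖x + h x‖ ^ 2` is locally constant. Were the derivative invertible, some `w` would be sent to
  -- `x + h x`, giving `2 * R ^ 2 = 0`.
  have hzero : ∀ x ∈ Metric.ball (0 : E) R, D 1 x = 0 := by
    intro x hx
    have hx' : ‖x‖ < R := by simpa using hx
    by_contra hne
    have hr : HasFDerivAt (fun x => x + h x) (ContinuousLinearMap.id ℝ E + fderiv ℝ h x) x :=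
      (hasFDerivAt_id x).add (hder x ((memB x).2 hx'.le))
    have hn := hr.norm_sq
    have hev : (fun x => ‖x + h x‖ ^ 2) =ᶠ[nhds x] fun _ => R ^ 2 := by
      filter_upwards [Metric.isOpen_ball.mem_nhds hx] with z hz
      rw [hret z (by simpa using (Metric.mem_ball.1 hz).le)]
    have hz := hn.unique ((hasFDerivAt_const (R ^ 2) x).congr_of_eventuallyEq hev)
    have hu : IsUnit (1 + (1 : ℝ) • (fderiv ℝ h x : E →ₗ[ℝ] E)) :=
      (LinearMap.isUnit_iff_isUnit_det _).2 (isUnit_iff_ne_zero.2 hne)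
    obtain ⟨w, hw⟩ := ((Module.End.isUnit_iff _).1 hu).2 (x + h x)
    have hw' : w + fderiv ℝ h x w = x + h x := by simpa using hw
    have h3 : (2 : ℕ) • inner ℝ (x + h x) (w + fderiv ℝ h x w) = 0 :=
      congrArg (fun L : E →L[ℝ] ℝ => L w) hz
    rw [hw', real_inner_self_eq_norm_sq, hret x hx'.le] at h3
    have h4 : R = 0 := by simpa using h3
    exact hR.ne' h4
  have h1 : ∫ x in B, D 1 x = 0 := by
    refine integral_eq_zero_of_ae ((ae_restrict_iff' hBm).2 ?_)
    filter_upwards [compl_mem_ae_iff.2 (Measure.addHaar_sphere_of_ne_zero volume (0 : E) hR.ne')]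
      with x hx hxB
    refine hzero x ?_
    rw [mem_ball_zero_iff]
    exact lt_of_le_of_ne ((memB x).1 hxB) fun he => hx (by simpa using he)
  have h2 : ∫ x in B, D 1 x = volume.real B := by
    calc ∫ x in B, D 1 x
        = ∫ x in B, ∑ j ∈ Finset.range (Module.finrank ℝ E + 1), c j * D (v j) x := by
          refine setIntegral_congr_fun hBm fun x _ => ?_
          obtain ⟨p, hpd, hpe⟩ :=
            LinearMap.exists_polynomial_det_one_add_smul (fderiv ℝ h x : E →ₗ[ℝ] E)
          have := hp p hpd
          simpa only [hpe] using this
      _ = ∑ j ∈ Finset.range (Module.finrank ℝ E + 1), c j * volume.real B := by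
          rw [integral_finsetSum _ hint]
          refine Finset.sum_congr rfl fun j hj => ?_
          rw [integral_const_mul, hvol j hj]
      _ = volume.real B := by rw [← Finset.sum_mul, hc, one_mul]
  have h3 : 0 < volume.real B := by
    refine ENNReal.toReal_pos (Metric.measure_closedBall_pos _ _ hR).ne' ?_
    exact (isCompact_closedBall (0 : E) R).measure_lt_top.ne
  exact h3.ne (h1.symm.trans h2)

open scoped ContDiff Manifold in
/-- **Brouwer's fixed point theorem** for bounded continuous self-maps of a Euclidean space. -/
theorem exists_eq_of_continuous_of_norm_le {E : Type*} [NormedAddCommGroup E]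
    [InnerProductSpace ℝ E] [FiniteDimensional ℝ E] {F : E → E} (hF : Continuous F) {R : ℝ}
    (hR : ∀ x, ‖F x‖ ≤ R) : ∃ x, F x = x := by
  by_contra! hne
  -- Smooth approximation of `F`, closer to `F x` than `x` is, hence still without fixed points.
  obtain ⟨g, hg⟩ := exists_contMDiffMap_forall_mem_convex_of_local_const (n := ⊤) 𝓘(ℝ, E)
    (t := fun x => Metric.ball (F x) (min 1 (dist (F x) x))) (fun x => convex_ball _ _)
    (fun x => ⟨F x, by
      have hc : Continuous fun y => min 1 (dist (F y) y) - dist (F x) (F y) := by fun_prop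
      have h0 : 0 < min 1 (dist (F x) x) - dist (F x) (F x) := by
        simpa using hne x
      filter_upwards [hc.continuousAt.eventually (lt_mem_nhds h0)] with y hy
      simpa using hy⟩)
  have hgs : ContDiff ℝ 1 g := g.contMDiff.contDiff.of_le (by norm_cast)
  have hgne : ∀ x, x - g x ≠ 0 := by
    intro x hx
    have h1 := hg x
    rw [← sub_eq_zero.1 hx] at h1
    have h2 : dist x (F x) < dist (F x) x := (lt_min_iff.1 (Metric.mem_ball.1 h1)).2
    rw [dist_comm] at h2
    exact lt_irrefl _ h2
  have hgR : ∀ x, ‖g x‖ < R + 1 := by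
    intro x
    have h1 : dist (g x) (F x) < 1 := (lt_min_iff.1 (Metric.mem_ball.1 (hg x))).1
    rw [dist_eq_norm] at h1
    have h2 := norm_le_norm_sub_add (g x) (F x)
    linarith [hR x]
  have hρ : 0 < R + 1 := (norm_nonneg _).trans_lt (hgR 0)
  set ρ := R + 1
  let u : E → E := fun x => x - g x
  have hu : ContDiff ℝ 1 u := contDiff_id.sub hgs
  -- Quarter discriminant of `‖x + c • u x‖ ^ 2 = ρ ^ 2` in `c`; the larger root, chosen below, is
  -- `0` on the sphere since `inner ℝ x (u x) > 0` there.
  let Δ : E → ℝ := fun x => inner ℝ x (u x) ^ 2 + ‖u x‖ ^ 2 * (ρ ^ 2 - ‖x‖ ^ 2)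
  have hΔ : ContDiff ℝ 1 Δ :=
    ((contDiff_id.inner ℝ hu).pow 2).add
      ((hu.norm_sq ℝ).mul (contDiff_const.sub (contDiff_id.norm_sq ℝ)))
  have hun : ∀ x, 0 < ‖u x‖ ^ 2 := fun x => pow_pos (norm_pos_iff.2 (hgne x)) 2
  have hinner : ∀ x, ‖x‖ = ρ → 0 < inner ℝ x (u x) := by
    intro x hx
    have h1 : inner ℝ x (u x) = ‖x‖ ^ 2 - inner ℝ x (g x) := by
      rw [inner_sub_right, real_inner_self_eq_norm_sq]
    have h2 := real_inner_le_norm x (g x)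
    rw [h1, hx]
    rw [hx] at h2
    nlinarith [hgR x]
  have hΔpos : ∀ x, ‖x‖ ≤ ρ → 0 < Δ x := by
    intro x hx
    rcases hx.lt_or_eq with h | h
    · have h1 : 0 < ρ ^ 2 - ‖x‖ ^ 2 := by nlinarith [norm_nonneg x]
      have h2 := mul_pos (hun x) h1
      have h3 := sq_nonneg (inner ℝ x (u x))
      exact add_pos_of_nonneg_of_pos h3 h2
    · have h1 := pow_pos (hinner x h) 2
      simpa [Δ, h] using h1
  let c : E → ℝ := fun x => (-inner ℝ x (u x) + √(Δ x)) / ‖u x‖ ^ 2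
  refine not_forall_norm_add_eq_of_contDiffAt (h := fun x => c x • u x) hρ ?_ ?_ ?_
  · intro x hx
    refine ContDiffAt.smul (ContDiffAt.div ?_ (hu.norm_sq ℝ).contDiffAt (hun x).ne')
      hu.contDiffAt
    exact (contDiff_id.inner ℝ hu).neg.contDiffAt.add
      (hΔ.contDiffAt.sqrt (hΔpos x hx).ne')
  · intro x hx
    have h1 : Δ x = inner ℝ x (u x) ^ 2 := by simp [Δ, hx]
    have h2 : c x = 0 := by simp [c, h1, Real.sqrt_sq (hinner x hx).le]
    simp [h2]
  · intro x hx
    have h1 := Real.sq_sqrt (hΔpos x hx).le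
    have h2 : c x * ‖u x‖ ^ 2 = -inner ℝ x (u x) + √(Δ x) := div_mul_cancel₀ _ (hun x).ne'
    have h3 : ‖x + c x • u x‖ ^ 2 = ρ ^ 2 := by
      rw [norm_add_sq_real, real_inner_smul_right, norm_smul, mul_pow, Real.norm_eq_abs, sq_abs]
      have h4 : (c x * ‖u x‖ ^ 2 + inner ℝ x (u x)) ^ 2 = Δ x := by
        rw [h2, neg_add_eq_sub, sub_add_cancel, h1]
      refine mul_left_cancel₀ (hun x).ne' ?_
      simp only [Δ] at h4
      linear_combination h4
    exact (pow_left_inj₀ (norm_nonneg _) hρ.le two_ne_zero).1 h3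

/-- **Brouwer's fixed point theorem** for continuous maps into a cube. -/
theorem exists_eq_of_continuous_of_mem_Icc {n : ℕ} {F : (Fin n → ℝ) → Fin n → ℝ}
    (hF : Continuous F) {x y : ℝ} (h : ∀ t i, F t i ∈ Set.Icc x y) : ∃ t, F t = t := by
  have hc : IsCompact (WithLp.toLp 2 '' Set.Icc (fun _ : Fin n => x) fun _ => y) :=
    isCompact_Icc.image (PiLp.continuous_toLp 2 _)
  obtain ⟨R, hR⟩ := hc.isBounded.exists_norm_le
  obtain ⟨t, ht⟩ := exists_eq_of_continuous_of_norm_le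
    (F := fun e : EuclideanSpace ℝ (Fin n) => WithLp.toLp 2 (F (WithLp.ofLp e))) (by fun_prop)
    fun e => hR _ ⟨_, ⟨fun i => (h _ i).1, fun i => (h _ i).2⟩, rfl⟩
  exact ⟨WithLp.ofLp t, congrArg WithLp.ofLp ht⟩

/-! ### Tuples extended by the endpoints -/

section ExtendTuple

variable {n : ℕ} {x y : ℝ} {t : Fin n → ℝ}

@[simp]
theorem extendTuple_zero : extendTuple x y t 0 = x := rfl

@[simp]
theorem extendTuple_succ (i : Fin n) : extendTuple x y t (i + 1) = t i := by
  simp [extendTuple]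

theorem extendTuple_of_lt {k : ℕ} (hk : n < k) : extendTuple x y t k = y := by
  rw [extendTuple, if_neg (by omega), dif_neg (by omega)]

theorem extendTuple_mem_Icc (hxy : x ≤ y) (ht : t ∈ orderedTuples n (Set.Icc x y)) (k : ℕ) :
    extendTuple x y t k ∈ Set.Icc x y := by
  unfold extendTuple
  split_ifs
  exacts [Set.left_mem_Icc.2 hxy, ht.1 _, Set.right_mem_Icc.2 hxy]

theorem monotone_extendTuple (hxy : x ≤ y) (ht : t ∈ orderedTuples n (Set.Icc x y)) :
    Monotone (extendTuple x y t) := by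
  refine monotone_nat_of_le_succ fun k => ?_
  rcases lt_or_ge k n with hk | hk
  · rw [extendTuple_succ ⟨k, hk⟩]
    rcases k with _ | k
    · exact (ht.1 _).1
    · rw [extendTuple_succ ⟨k, by omega⟩]
      exact ht.2 (Fin.mk_le_mk.2 (Nat.le_succ k))
  · rw [extendTuple_of_lt (Nat.lt_succ_of_le hk)]
    exact (extendTuple_mem_Icc hxy ht k).2

theorem continuous_extendTuple (k : ℕ) : Continuous fun t : Fin n → ℝ => extendTuple x y t k := by
  unfold extendTuple
  split_ifs <;> fun_prop

end ExtendTuple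

/-! ### Existence, compactness, strictness and uniqueness of fixed points -/

section FixedPoints

variable {I : Set ℝ} {n : ℕ} {M : ℕ → ℝ → ℝ → ℝ} {x y : ℝ}

theorem phi_mem_Icc_extendTuple (hI : Set.Icc x y ⊆ I) (hM : ∀ i ∈ Set.Icc 1 n, IsMeanOn I (M i))
    (hxy : x ≤ y) {t : Fin n → ℝ} (ht : t ∈ orderedTuples n (Set.Icc x y)) (i : Fin n) :
    phi M x y t i ∈ Set.Icc (extendTuple x y t i) (extendTuple x y t (i + 2)) :=
  hM (i + 1) ⟨by omega, by omega⟩ _ (hI (extendTuple_mem_Icc hxy ht _)) _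
    (hI (extendTuple_mem_Icc hxy ht _)) (monotone_extendTuple hxy ht (by omega))

theorem continuousOn_phi (hI : Set.Icc x y ⊆ I)
    (hc : ∀ i ∈ Set.Icc 1 n, IsContinuousMeanOn I (M i)) (hxy : x ≤ y) :
    ContinuousOn (phi (n := n) M x y) (orderedTuples n (Set.Icc x y)) := by
  refine continuousOn_pi.2 fun i => ?_
  exact (hc (i + 1) ⟨by omega, by omega⟩).comp
    (f := fun t => (extendTuple x y t i, extendTuple x y t (i + 2)))
    ((continuous_extendTuple _).prodMk (continuous_extendTuple _)).continuousOn
    fun t ht => ⟨hI (extendTuple_mem_Icc hxy ht i), hI (extendTuple_mem_Icc hxy ht (i + 2)),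
      monotone_extendTuple hxy ht (Nat.le_add_right (i : ℕ) 2)⟩

theorem isCompact_orderedTuples : IsCompact (orderedTuples n (Set.Icc x y)) := by
  have h1 : IsCompact (Set.Icc (fun _ : Fin n => x) fun _ => y) := isCompact_Icc
  have h2 : IsClosed {t : Fin n → ℝ | Monotone t} := isClosed_monotone
  convert h1.inter_right h2 using 1
  ext t
  simp [orderedTuples, Pi.le_def, forall_and]

theorem isCompact_fixedPointSet (hI : Set.Icc x y ⊆ I)
    (hc : ∀ i ∈ Set.Icc 1 n, IsContinuousMeanOn I (M i)) (hxy : x ≤ y) :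
    IsCompact (fixedPointSet n M x y) := by
  have h := isCompact_orderedTuples (n := n) (x := x) (y := y)
  refine h.of_isClosed_subset ?_ fun _ hξ => hξ.1
  have := ((continuousOn_phi hI hc hxy).prodMk continuousOn_id).preimage_isClosed_of_isClosed
    h.isClosed isClosed_diagonal
  exact this

/-- Composing `phi` with the running maximum gives a self-map of the cube, all of whose fixed
points are increasing. -/
theorem nonempty_fixedPointSet (hI : Set.Icc x y ⊆ I) (hM : ∀ i ∈ Set.Icc 1 n, IsMeanOn I (M i))
    (hc : ∀ i ∈ Set.Icc 1 n, IsContinuousMeanOn I (M i)) (hxy : x ≤ y) :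
    (fixedPointSet n M x y).Nonempty := by
  let r : (Fin n → ℝ) → Fin n → ℝ := fun t => partialSups fun i => (Set.projIcc x y hxy (t i) : ℝ)
  have hr : ∀ t, r t ∈ orderedTuples n (Set.Icc x y) := fun t =>
    ⟨fun i => ⟨(Set.projIcc x y hxy (t i)).2.1.trans
        (le_partialSups (fun i => (Set.projIcc x y hxy (t i) : ℝ)) i),
      partialSups_le _ _ _ fun j _ => (Set.projIcc x y hxy (t j)).2.2⟩, (partialSups _).monotone⟩
  have hrc : Continuous r := by
    refine continuous_pi fun i => ?_
    simp only [r, partialSups_apply]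
    exact Continuous.finset_sup'_apply _ fun j _ =>
      continuous_subtype_val.comp (continuous_projIcc.comp (continuous_apply j))
  have hphi := fun t => phi_mem_Icc_extendTuple hI hM hxy (hr t)
  have hmem : ∀ t i, phi M x y (r t) i ∈ Set.Icc x y := fun t i =>
    ⟨(extendTuple_mem_Icc hxy (hr t) _).1.trans (hphi t i).1,
      (hphi t i).2.trans (extendTuple_mem_Icc hxy (hr t) _).2⟩
  obtain ⟨t, ht⟩ := exists_eq_of_continuous_of_mem_Icc (F := fun t => phi M x y (r t))
    ((continuousOn_phi hI hc hxy).comp_continuous hrc hr) hmem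
  have htm : ∀ i, t i ∈ Set.Icc x y := fun i => by
    have := hmem t i
    rwa [show phi M x y (r t) = t from ht] at this
  have hproj : (fun i => (Set.projIcc x y hxy (t i) : ℝ)) = t := by
    funext i
    rw [Set.projIcc_of_mem hxy (htm i)]
  have hmono : Monotone t := by
    -- For `i < j`, `t j` is at least its left argument, a running maximum that already includes `t
    -- i`.
    refine monotone_iff_forall_lt.2 fun i j hij => ?_
    have hj := (hphi t j).1
    rw [show phi M x y (r t) = t from ht] at hj
    obtain ⟨k, hk⟩ : ∃ k, (j : ℕ) = k + 1 := ⟨j - 1, by omega⟩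
    rw [hk, extendTuple_succ ⟨k, by omega⟩] at hj
    refine le_trans ?_ hj
    simp only [r, hproj]
    exact le_partialSups_of_le t (Fin.le_def.2 (by simp only; omega))
  have hrt : r t = t := by
    simp only [r, hproj]
    exact hmono.partialSups_eq
  refine ⟨t, ⟨htm, hmono⟩, ?_⟩
  conv_rhs => rw [← ht]
  simp only [hrt]

theorem extendTuple_succ_eq_of_mem_fixedPointSet {ξ : Fin n → ℝ} (hξ : ξ ∈ fixedPointSet n M x y)
    {k : ℕ} (hk : k < n) : extendTuple x y ξ (k + 1) =
      M (k + 1) (extendTuple x y ξ k) (extendTuple x y ξ (k + 2)) := by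
  rw [extendTuple_succ ⟨k, hk⟩]
  exact (congrFun hξ.2 ⟨k, hk⟩).symm

theorem fixedPointSet_subset_strictOrderedTuples (hI : Set.Icc x y ⊆ I)
    (hs : ∀ i ∈ Set.Icc 1 n, IsStrictMeanOn I (M i)) (hxy : x < y) :
    fixedPointSet n M x y ⊆ strictOrderedTuples n (Set.Ioo x y) := by
  intro ξ hξ
  set T := extendTuple x y ξ with hT
  have hmono : Monotone T := monotone_extendTuple hxy.le hξ.1
  have hmem : ∀ k, T k ∈ I := fun k => hI (extendTuple_mem_Icc hxy.le hξ.1 k)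
  have hstep : ∀ k < n, T k < T (k + 2) → T k < T (k + 1) ∧ T (k + 1) < T (k + 2) := by
    intro k hk hlt
    have := hs (k + 1) ⟨by omega, by omega⟩ _ (hmem k) _ (hmem (k + 2)) hlt
    rwa [← extendTuple_succ_eq_of_mem_fixedPointSet hξ hk] at this
  -- If either gap is positive, so is their sum, and strictness then splits it into two positive
  -- gaps.
  have hiff : ∀ k < n, T k < T (k + 1) ↔ T (k + 1) < T (k + 2) := fun k hk =>
    ⟨fun h => (hstep k hk (h.trans_le (hmono (by omega)))).2,
      fun h => (hstep k hk ((hmono (by omega)).trans_lt h)).1⟩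
  have hall : ∀ k ≤ n, (T k < T (k + 1) ↔ T 0 < T 1) := by
    intro k hk
    induction k with
    | zero => rfl
    | succ k ih => rw [← hiff k hk, ih (by omega)]
  have h01 : T 0 < T 1 := by
    by_contra h
    have hconst : ∀ k ≤ n + 1, T k = T 0 := by
      intro k hk
      induction k with
      | zero => rfl
      | succ k ih =>
        rw [← ih (by omega)]
        exact le_antisymm (not_lt.1 fun hlt => h ((hall k (by omega)).1 hlt)) (hmono (by omega))
    have := hconst (n + 1) le_rfl
    rw [hT, extendTuple_of_lt (Nat.lt_succ_self n), extendTuple_zero] at this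
    exact hxy.ne' this
  have hlt : ∀ k ≤ n, T k < T (k + 1) := fun k hk => (hall k hk).2 h01
  have hval : ∀ i : Fin n, T (i + 1) = ξ i := fun i => extendTuple_succ i
  refine ⟨fun i => ?_, fun i j hij => ?_⟩
  · rw [← hval]
    constructor
    · exact (hmono (Nat.zero_le _)).trans_lt (hlt i (by omega))
    · refine (hlt (i + 1) (by omega)).trans_le ?_
      exact (extendTuple_mem_Icc hxy.le hξ.1 _).2
  · rw [← hval, ← hval]
    exact (hlt (i + 1) (by omega)).trans_le (hmono (by simp only [Fin.lt_def] at hij; omega))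

/-- A nonnegative solution of the tridiagonal system of inequalities vanishes, provided that the
numbers `wSeq a b i` are positive. -/
theorem eq_zero_of_wSeq_pos {m : ℕ} {a b δ : ℕ → ℝ} (ha : ∀ i ∈ Set.Icc 2 (m + 2), 0 < a i)
    (hw : ∀ i ∈ Set.Icc 1 (m + 1), 0 < wSeq a b i)
    (hδ : ∀ i ∈ Set.Icc 1 (m + 2), 0 ≤ δ i) (h1 : δ 1 ≤ b 1 * δ 2)
    (h2 : ∀ i < m, δ (i + 2) ≤ a (i + 2) * δ (i + 1) + b (i + 2) * δ (i + 3))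
    (h3 : δ (m + 2) ≤ a (m + 2) * δ (m + 1)) : ∀ i ∈ Set.Icc 1 (m + 2), δ i = 0 := by
  -- Shifted indexing `v k = w_{k-1}`, so that `v 0 = w_{-1}`; the recursion becomes uniform.
  let v : ℕ → ℝ := fun k => Nat.casesOn k 1 (wSeq a b)
  have hv : ∀ k, v (k + 2) = v (k + 1) - a (k + 2) * b (k + 1) * v k := by
    rintro (_ | k)
    · rfl
    · rfl
  have hvpos : ∀ k ≤ m + 2, 0 < v k := by
    rintro (_ | _ | k) hk
    · exact one_pos
    · exact one_pos
    · exact hw (k + 1) ⟨by omega, by omega⟩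
  -- Forward elimination: each unknown is bounded by its right neighbour.
  have hup : ∀ k ≤ m, v (k + 1) * δ (k + 1) ≤ b (k + 1) * v k * δ (k + 2) := by
    intro k hk
    induction k with
    | zero => simpa [v, wSeq] using h1
    | succ k ih =>
      have e1 := mul_le_mul_of_nonneg_left (ih (by omega)) (ha (k + 2) ⟨by omega, by omega⟩).le
      have e2 := mul_le_mul_of_nonneg_left (h2 k (by omega)) (hvpos (k + 1) (by omega)).le
      rw [hv k]
      linarith
  have hlast : δ (m + 2) = 0 := by
    have e1 := mul_le_mul_of_nonneg_left (hup m le_rfl) (ha (m + 2) ⟨by omega, by omega⟩).le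
    have e2 := mul_le_mul_of_nonneg_left h3 (hvpos (m + 1) (by omega)).le
    have e3 : v (m + 2) * δ (m + 2) ≤ 0 := by
      rw [hv m]
      linarith
    exact le_antisymm (nonpos_of_mul_nonpos_right e3 (hvpos (m + 2) le_rfl))
      (hδ _ ⟨by omega, le_rfl⟩)
  -- Back substitution: a zero at `k + 2` propagates to `k + 1` through `hup`.
  have hdown : ∀ j ≤ m + 1, δ (m + 2 - j) = 0 := by
    intro j hj
    induction j with
    | zero => exact hlast
    | succ j ih =>
      obtain ⟨k, hk⟩ : ∃ k, m + 2 - (j + 1) = k + 1 := ⟨m - j, by omega⟩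
      have h0 := ih (by omega)
      rw [show m + 2 - j = k + 2 by omega] at h0
      have e1 := hup k (by omega)
      rw [h0, mul_zero] at e1
      rw [hk]
      exact le_antisymm (nonpos_of_mul_nonpos_right e1 (hvpos (k + 1) (by omega)))
        (hδ _ ⟨by omega, by omega⟩)
  intro i hi
  have := hdown (m + 2 - i) (by have := hi.1; omega)
  rwa [show m + 2 - (m + 2 - i) = i by have := hi.2; omega] at this

theorem subsingleton_fixedPointSet (hn : 2 ≤ n) (hxy : x ≤ y) {d : ℕ → ℝ → ℝ → ℝ} {a b : ℕ → ℝ}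
    (hd : ∀ i ∈ Set.Icc 1 n, IsSemimetricOn (Set.Icc x y) (d i))
    (ha : ∀ i ∈ Set.Icc 2 n, 0 < a i)
    (hw : ∀ i ∈ Set.Icc 1 (n - 1), 0 < wSeq a b i)
    (hL : LipschitzEstimates n M d a b x y) : (fixedPointSet n M x y).Subsingleton := by
  intro ξ hξ η hη
  obtain ⟨m, rfl⟩ : ∃ m, n = m + 2 := ⟨n - 2, by omega⟩
  obtain ⟨hL1, hL2, hL3⟩ := hL
  have hξm := extendTuple_mem_Icc hxy hξ.1
  have hηm := extendTuple_mem_Icc hxy hη.1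
  have hξe : ∀ k < m + 2, _ := fun k hk => extendTuple_succ_eq_of_mem_fixedPointSet hξ hk
  have hηe : ∀ k < m + 2, _ := fun k hk => extendTuple_succ_eq_of_mem_fixedPointSet hη hk
  have hzero := eq_zero_of_wSeq_pos (δ := fun k => d k (extendTuple x y ξ k) (extendTuple x y η k))
    ha hw (fun i hi => ((hd i hi).1 _ (hξm i) _ (hηm i)).1)
    (by
      have := hL1 _ (hξm 2) _ (hηm 2)
      have e1 := hξe 0 (by omega)
      have e2 := hηe 0 (by omega)
      simp only [zero_add, extendTuple_zero] at e1 e2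
      rwa [← e1, ← e2] at this)
    (by
      intro i hi
      have := hL2 (i + 2) ⟨by omega, by omega⟩ _ (hξm (i + 1)) _ (hξm (i + 3)) _ (hηm (i + 1)) _
        (hηm (i + 3)) (monotone_extendTuple hxy hξ.1 (by omega))
        (monotone_extendTuple hxy hη.1 (by omega))
      have e1 := hξe (i + 1) (by omega)
      have e2 := hηe (i + 1) (by omega)
      rwa [← e1, ← e2] at this)
    (by
      have := hL3 _ (hξm (m + 1)) _ (hηm (m + 1))
      have e1 := hξe (m + 1) (by omega)
      have e2 := hηe (m + 1) (by omega)
      -- The right neighbour of the last entry is the endpoint `y`.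
      rw [extendTuple_of_lt (k := m + 1 + 2) (by omega)] at e1 e2
      rwa [← e1, ← e2] at this)
  funext i
  have hi : (i : ℕ) + 1 ∈ Set.Icc 1 (m + 2) := ⟨by omega, by omega⟩
  have := (((hd _ hi).1 _ (hξm _) _ (hηm _)).2).1 (hzero _ hi)
  simpa using this

end FixedPoints

theorem mainTheorem2
    (I : Set ℝ) (hI : I.OrdConnected) (n : ℕ) (hn : 2 ≤ n)
    (M : ℕ → ℝ → ℝ → ℝ) (hM : ∀ i ∈ Set.Icc 1 n, IsMeanOn I (M i))
    (x y : ℝ) (hx : x ∈ I) (hy : y ∈ I) (hxy : x < y) :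
    ((∀ i ∈ Set.Icc 1 n, IsContinuousMeanOn I (M i)) →
      (fixedPointSet n M x y).Nonempty ∧ IsCompact (fixedPointSet n M x y)) ∧
    ((∀ i ∈ Set.Icc 1 n, IsStrictMeanOn I (M i)) →
      fixedPointSet n M x y ⊆ strictOrderedTuples n (Set.Ioo x y)) ∧
    ((∃ (d : ℕ → ℝ → ℝ → ℝ) (a b : ℕ → ℝ),
        (∀ i ∈ Set.Icc 1 n, IsSemimetricOn (Set.Icc x y) (d i)) ∧
        (∀ i ∈ Set.Icc 2 n, 0 < a i) ∧
        (∀ i ∈ Set.Icc 1 (n - 1), 0 < b i) ∧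
        (∀ i ∈ Set.Icc 1 (n - 1), 0 < wSeq a b i) ∧
        LipschitzEstimates n M d a b x y) →
      (fixedPointSet n M x y).Subsingleton ∧
      ((∀ i ∈ Set.Icc 1 n, IsContinuousMeanOn I (M i)) →
        ∃ ξ, fixedPointSet n M x y = {ξ})) := by
  have hsub : Set.Icc x y ⊆ I := hI.out hx hy
  refine ⟨fun hc => ⟨nonempty_fixedPointSet hsub hM hc hxy.le,
      isCompact_fixedPointSet hsub hc hxy.le⟩,
    fun hs => fixedPointSet_subset_strictOrderedTuples hsub hs hxy, ?_⟩
  rintro ⟨d, a, b, hd, ha, -, hw, hL⟩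
  have huniq := subsingleton_fixedPointSet hn hxy.le hd ha hw hL
  refine ⟨huniq, fun hc => ?_⟩
  obtain ⟨ξ, hξ⟩ := nonempty_fixedPointSet hsub hM hc hxy.le
  exact ⟨ξ, huniq.eq_singleton_of_mem hξ⟩
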